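/- For $n\ge 0$ call a map $\psi:\{0,1\}^n\to\{0,1\}^m$ a cube morphism if it extends to an affine homomorphism (a homomorphism plus a translation) $\mathbb Z^n\to\mathbb Z^m$. A cubespace is a set $N$ with sets $C^n(N)\subseteq N^{\{0,1\}^n}$ ($n\ge 0$) such that $f\circ\psi\in C^n(N)$ for every $f\in C^m(N)$ and every cube morphism $\psi:\{0,1\}^n\to\{0,1\}^m$. A map $\phi:M\to N$ of cubespaces is a morphism if $\phi\circ c\in C^n(N)$ for all $n$ and all $c\in C^n(M)$. A cubespace $N$ is a nilspace if $C^1(N)=N^{\{0,1\}}$ and, for every $n\ge 1$, each map $\{0,1\}^n\setminus\{1^n\}\to N$ whose restriction to every $(n-1)$-dimensional face containing $0^n$ is in $C^{n-1}(N)$ extends to an element of $C^n(N)$; it is an $s$-step nilspace if moreover this extension is unique for $n=s+1$. For an abelian group $A$, $\mathcal D_i(A)$ is the set $A$ in which $f:\{0,1\}^n\to A$ is a cube if and only if $\sum_{v\in\{0,1\}^{i+1}}(-1)^{v_1+\dots+v_{i+1}}f(\theta(v))=0$ for every cube morphism $\theta:\{0,1\}^{i+1}\to\{0,1\}^n$.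 Cubes in products are defined componentwise, and $F(a_1,\dots,a_k)=\prod_{i=1}^k\mathcal D_i(\mathbb Z^{a_i})$ for natural numbers $a_1,\dots,a_k$. **Theorem.** Let $N$ be a finite nilspace with $|N|=n$ that is $s$-step for some natural number $s$. 1. Let $\phi:F\to N$ be a morphism from a free nilspace $F=F(a_1,\dots,a_k)$. Then there is a natural number $\alpha$ such that $\phi$ factors through the map $\psi:F\to\prod_{i=1}^k\mathcal D_i\big((\mathbb Z/n^\alpha\mathbb Z)^{a_i}\big)$ that takes every coordinate mod $n^\alpha$; that is, there is a morphism $\phi':\prod_{i=1}^k\mathcal D_i\big((\mathbb Z/n^\alpha\mathbb Z)^{a_i}\big)\to N$ with $\phi=\phi'\circ\psi$. 2. There is a natural number $\alpha$ such that, for every $i\ge 1$, every morphism $\phi:\mathcal D_i(\mathbb Z)\to N$ is $n^\alpha$-periodic, i.e. $\phi(x+n^\alpha)=\phi(x)$ for all $x\in\mathbb Z$. -/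

import Mathlib

namespace Nilspaces

/-- The abstract discrete cube `{0,1}^n`. -/
abbrev Cube (n : ℕ) : Type := Fin n → Bool

/-- The inclusion of `{0,1}^n` into `ℤ^n`. -/
def Cube.toInt {n : ℕ} (v : Cube n) : Fin n → ℤ := fun i => if v i then 1 else 0

/-- The number of coordinates of `v` equal to `1`. -/
def Cube.height {n : ℕ} (v : Cube n) : ℕ := ∑ i, if v i then 1 else 0

/-- A cube morphism `{0,1}^n → {0,1}^m`: a map that extends to an affine homomorphism
(a homomorphism plus a translation) `ℤ^n → ℤ^m`. -/
def IsCubeMorphism {n m : ℕ} (ψ : Cube n → Cube m) : Prop :=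
  ∃ (L : (Fin n → ℤ) →+ (Fin m → ℤ)) (b : Fin m → ℤ),
    ∀ v : Cube n, (ψ v).toInt = L v.toInt + b

theorem IsCubeMorphism.comp {l n m : ℕ} {ψ : Cube n → Cube m} {χ : Cube l → Cube n}
    (hψ : IsCubeMorphism ψ) (hχ : IsCubeMorphism χ) : IsCubeMorphism (ψ ∘ χ) := by
  obtain ⟨L, b, hL⟩ := hψ
  obtain ⟨K, c, hK⟩ := hχ
  refine ⟨L.comp K, L c + b, fun v => ?_⟩
  simp only [Function.comp_apply, hL, hK, map_add, AddMonoidHom.comp_apply, add_assoc]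

/-- A cubespace structure on `N`: for every `n` a set of cubes `{0,1}^n → N`, closed under
precomposition with cube morphisms. -/
structure Cubespace (N : Type*) where
  cubes : (n : ℕ) → Set (Cube n → N)
  comp_mem : ∀ {n m : ℕ} (ψ : Cube n → Cube m), IsCubeMorphism ψ →
    ∀ f ∈ cubes m, f ∘ ψ ∈ cubes n

/-- A map between cubespaces is a morphism if it sends cubes to cubes. -/
def IsMorphism {M N : Type*} (X : Cubespace M) (Y : Cubespace N) (φ : M → N) : Prop :=
  ∀ (n : ℕ), ∀ c ∈ X.cubes n, φ ∘ c ∈ Y.cubes n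

/-- `f` restricted to each `n`-dimensional face of `{0,1}^{n+1}` containing `0^{n+1}` is a cube.
These faces are the sets `{v | v i = 0}`, and none of them contains `1^{n+1}`, so that the value
of `f` there plays no role. -/
def Cubespace.IsCorner {N : Type*} (X : Cubespace N) {n : ℕ} (f : Cube (n + 1) → N) : Prop :=
  ∀ i : Fin (n + 1), (fun v : Cube n => f (i.insertNth (α := fun _ => Bool) false v)) ∈ X.cubes n

/-- `c` is a cube that agrees with `f` on `{0,1}^n \ {1^n}`. -/
def Cubespace.IsCompletion {N : Type*} (X : Cubespace N) {n : ℕ} (f c : Cube n → N) : Prop :=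
  c ∈ X.cubes n ∧ ∀ v : Cube n, v ≠ (fun _ => true) → c v = f v

/-- The nilspace axioms (composition is part of `Cubespace`): ergodicity and gluing. -/
structure Cubespace.IsNilspace {N : Type*} (X : Cubespace N) : Prop where
  ergodic : X.cubes 1 = Set.univ
  gluing : ∀ (n : ℕ) (f : Cube (n + 1) → N), X.IsCorner f → ∃ c, X.IsCompletion f c

/-- A `k`-step nilspace: a nilspace in which gluing is unique in dimension `k + 1`. -/
structure Cubespace.IsStepNilspace {N : Type*} (X : Cubespace N) (k : ℕ) : Prop
    extends X.IsNilspace where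
  unique_gluing : ∀ f : Cube (k + 1) → N, X.IsCorner f → ∃! c, X.IsCompletion f c

/-- The `k`-degree structure `𝒟_k(A)` on an abelian group `A`. -/
def degreeSpace (k : ℕ) (A : Type*) [AddCommGroup A] : Cubespace A where
  cubes n := {f | ∀ φ : Cube (k + 1) → Cube n, IsCubeMorphism φ →
    ∑ v : Cube (k + 1), (-1 : ℤ) ^ v.height • f (φ v) = 0}
  comp_mem ψ hψ _ hf φ hφ := hf (ψ ∘ φ) (hψ.comp hφ)

/-- The product of cubespaces: a map is a cube if and only if each of its components is. -/
def Cubespace.pi {ι : Type*} {N : ι → Type*} (X : (i : ι) → Cubespace (N i)) :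
    Cubespace ((i : ι) → N i) where
  cubes n := {f | ∀ i, (fun v => f v i) ∈ (X i).cubes n}
  comp_mem ψ hψ _ hf i := (X i).comp_mem ψ hψ _ (hf i)

/-- The free nilspace `F(a_1, …, a_k) = ∏_{i=1}^k 𝒟_i(ℤ^{a_i})`.
The index `i : Fin k` runs from `0`, so it stands for the degree `i + 1`. -/
def freeNilspace {k : ℕ} (a : Fin k → ℕ) : Cubespace ((i : Fin k) → Fin (a i) → ℤ) :=
  Cubespace.pi fun i => degreeSpace ((i : ℕ) + 1) (Fin (a i) → ℤ)

/-- The space `F / m = ∏_{i=1}^k 𝒟_i((ℤ/m)^{a_i})`. -/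
def modFreeNilspace (m : ℕ) {k : ℕ} (a : Fin k → ℕ) :
    Cubespace ((i : Fin k) → Fin (a i) → ZMod m) :=
  Cubespace.pi fun i => degreeSpace ((i : ℕ) + 1) (Fin (a i) → ZMod m)

/-- The map `F → F / m` that takes every coordinate mod `m`. -/
def reduceMod (m : ℕ) {k : ℕ} (a : Fin k → ℕ) (x : (i : Fin k) → Fin (a i) → ℤ) :
    (i : Fin k) → Fin (a i) → ZMod m :=
  fun i j => (x i j : ZMod m)

end Nilspaces

namespace Nilspaces

/-! The relations `Rel (k + 1)` filter `N`: `Rel 1` relates everything, and `Rel (s + 1)` is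
equality by unique gluing. Each fibre of the quotient by `Rel (k + 2)` over the quotient by `Rel (k
+ 1)` is an abelian group in which `EdgeRel` means `b - a = d - c`. Fibres over different points
have the same size, so their order divides `n = |N|`. All of this rests on `tricube`.

A morphism `𝒟_i(ℤ) → N` with `i ≥ 1` sends the cubes `x + h (v_1 + ... + v_d)` to cubes. If such a
map stays in one class of `Rel (k + 1)`, then modulo `Rel (k + 2)` it is a map into a fibre whose
differences of order `k + 2` vanish (`iterate_fwdDiff_eq_zero`). The fibre is killed by `n`, so this
map has period `n ^ (k + 1)`. Hence on the multiples of `n ^ (k + 1)` the original map stays in one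
class of `Rel (k + 2)`. After `s` rounds of rescaling it is constant on the multiples of `n ^ α`,
with `α` depending only on `s`; applied to translates, this is part 2.

For part 1, periodicity along the coordinate lines shows that `φ` depends only on residues mod `n ^
α`. The induced map is a morphism because cubes of a degree structure lift along surjective
homomorphisms (`exists_lift_degreeSpace`). -/

theorem isCubeMorphism_of_coord {n m : ℕ} {ψ : Cube n → Cube m}
    (h : ∀ i, (∃ b, ∀ v, ψ v i = b) ∨ (∃ k, ∀ v, ψ v i = v k) ∨ ∃ k, ∀ v, ψ v i = !v k) :
    IsCubeMorphism ψ := by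
  have key : ∀ i, ∃ (L : (Fin n → ℤ) →+ ℤ) (b : ℤ), ∀ v, (ψ v).toInt i = L v.toInt + b := by
    intro i
    rcases h i with ⟨b, hb⟩ | ⟨k, hk⟩ | ⟨k, hk⟩
    · exact ⟨0, if b then 1 else 0, fun v => by simp [Cube.toInt, hb]⟩
    · exact ⟨Pi.evalAddMonoidHom _ k, 0, fun v => by simp [Cube.toInt, hk]⟩
    · refine ⟨-Pi.evalAddMonoidHom _ k, 1, fun v => ?_⟩
      cases hv : v k <;> simp [Cube.toInt, hk, hv]
  choose L b hL using key
  exact ⟨AddMonoidHom.pi L, b, fun v => funext fun i => hL i v⟩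

variable {N : Type*} {X : Cubespace N}

theorem Cubespace.comp_coord_mem (X : Cubespace N) {n m : ℕ} {f : Cube m → N}
    (hf : f ∈ X.cubes m) (ψ : Cube n → Cube m)
    (h : ∀ i, (∃ b, ∀ v, ψ v i = b) ∨ (∃ k, ∀ v, ψ v i = v k) ∨ ∃ k, ∀ v, ψ v i = !v k) :
    (fun v => f (ψ v)) ∈ X.cubes n :=
  X.comp_mem ψ (isCubeMorphism_of_coord h) f hf

/-! ### Simplicial completion and tricube composition -/

namespace Cubespace.IsNilspace

theorem const_mem (hX : X.IsNilspace) (n : ℕ) (x : N) : (fun _ => x) ∈ X.cubes n := by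
  have h : (fun _ : Cube 1 => x) ∈ X.cubes 1 := by rw [hX.ergodic]; trivial
  exact X.comp_coord_mem (n := n) h (fun _ _ => true) fun _ => Or.inl ⟨true, fun _ => rfl⟩

theorem ite_coord_mem (hX : X.IsNilspace) {n : ℕ} (i : Fin n) (x y : N) :
    (fun v : Cube n => if v i then y else x) ∈ X.cubes n := by
  have h : (fun v : Cube 1 => if v 0 then y else x) ∈ X.cubes 1 := by rw [hX.ergodic]; trivial
  exact X.comp_coord_mem (n := n) h (fun v _ => v i) fun _ => Or.inr (Or.inl ⟨i, fun _ => rfl⟩)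

/-- A map whose restrictions to all proper faces below `v` are cubes can be changed at `v` so that
its restriction to the face below `v` is a cube. -/
theorem exists_update (hX : X.IsNilspace) {n : ℕ} (f : Cube n → N) (v : Cube n)
    (hf : ∀ w < v, (fun u => f (u ⊓ w)) ∈ X.cubes n) :
    ∃ y, (fun u => Function.update f v y (u ⊓ v)) ∈ X.cubes n := by
  classical
  obtain ⟨k, ⟨σ⟩⟩ : ∃ k, Nonempty (Fin k ≃ {i // v i = true}) :=
    ⟨_, ⟨(Fintype.equivFin _).symm⟩⟩
  -- `ι` parametrizes the face below `v` by a cube of dimension `k`, the height of `v`.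
  let ι : Cube k → Cube n := fun u i => if h : v i = true then u (σ.symm ⟨i, h⟩) else false
  have hι : ∀ u : Cube n, ι (fun l => u (σ l)) = u ⊓ v := by
    intro u
    funext i
    by_cases h : v i = true <;> simp [ι, h]
  cases k with
  | zero =>
    have hv : v = ⊥ := by
      funext i
      by_contra h
      exact (σ.symm ⟨i, by simpa using h⟩).elim0
    refine ⟨f v, ?_⟩
    have : (fun u => Function.update f v (f v) (u ⊓ v)) = fun _ => f v := by
      funext u
      simp [hv]
    rw [this]
    exact hX.const_mem n _
  | succ k =>
    have hcorner : X.IsCorner (fun u => f (ι u)) := by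
      intro l
      have hlt : Function.update v (σ l) false < v := by
        rw [update_lt_self_iff, (σ l).2]
        decide
      have := X.comp_coord_mem (hf _ hlt)
        (fun u : Cube k => ι (l.insertNth (α := fun _ => Bool) false u)) (fun i => by
          by_cases h : v i = true
          · rcases Fin.eq_self_or_eq_succAbove l (σ.symm ⟨i, h⟩) with hl | ⟨j, hl⟩
            · exact Or.inl ⟨false, fun u => by simp [ι, h, hl]⟩
            · exact Or.inr (Or.inl ⟨j, fun u => by simp [ι, h, hl]⟩)
          · exact Or.inl ⟨false, fun u => by simp [ι, h]⟩)
      convert this using 3 with u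
      funext i
      by_cases hi : i = σ l
      · subst hi
        simp [ι, (σ l).2]
      · by_cases h : v i = true <;> simp [ι, h, hi]
    obtain ⟨c, hc, hcf⟩ := hX.gluing k _ hcorner
    refine ⟨c ⊤, ?_⟩
    have := X.comp_coord_mem hc (fun (u : Cube n) l => u (σ l))
      fun l => Or.inr (Or.inl ⟨σ l, fun _ => rfl⟩)
    convert this using 2 with u
    by_cases hu : u ⊓ v = v
    · have : (fun l => u (σ l)) = ⊤ := by
        funext l
        have := congrFun hu (σ l)
        simpa [(σ l).2] using this
      rw [hu, this, Function.update_self]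
    · rw [Function.update_of_ne hu, hcf]
      · exact congrArg f (hι u).symm
      intro h
      refine hu (funext fun i => ?_)
      by_cases hi : v i = true
      · have := congrFun h (σ.symm ⟨i, hi⟩)
        simp only [Equiv.apply_symm_apply] at this
        simp [hi, this]
      · simp [hi]

/-- Simplicial completion. -/
theorem exists_extension (hX : X.IsNilspace) {n : ℕ} (S : Set (Cube n)) (hS : IsLowerSet S)
    (f : Cube n → N) (hf : ∀ v ∈ S, (fun w => f (w ⊓ v)) ∈ X.cubes n) :
    ∃ c ∈ X.cubes n, ∀ v ∈ S, c v = f v := by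
  classical
  induction hk : Sᶜ.ncard using Nat.strong_induction_on generalizing S f with
  | _ k ih =>
    subst hk
    rcases Set.eq_empty_or_nonempty Sᶜ with h | h
    · rw [Set.compl_empty_iff] at h
      refine ⟨f, ?_, fun _ _ => rfl⟩
      simpa using hf ⊤ (by simp [h])
    -- Everything strictly below a minimal missing vertex is already in `S`, so that vertex can be
    -- filled by one corner completion.
    · obtain ⟨v, hv⟩ := (Set.toFinite Sᶜ).exists_minimal h
      have hlt : ∀ w < v, w ∈ S := fun w hw => by
        by_contra hwS
        exact hv.not_lt hwS hw
      have hvS : v ∉ S := hv.prop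
      obtain ⟨y, hy⟩ := hX.exists_update f v fun w hw => hf w (hlt w hw)
      have hlow : IsLowerSet (insert v S) := by
        rintro a b hba (rfl | ha)
        · rcases hba.eq_or_lt with rfl | h
          · exact Or.inl rfl
          · exact Or.inr (hlt _ h)
        · exact Or.inr (hS hba ha)
      obtain ⟨c, hc, hcf⟩ := ih (insert v S)ᶜ.ncard (by
          refine Set.ncard_lt_ncard ?_ (Set.toFinite _)
          exact compl_lt_compl_iff_lt.2 (Set.ssubset_insert hvS)) (insert v S) hlow (Function.update f v y) (by
          rintro w (rfl | hw)
          · exact hy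
          · convert hf w hw using 2 with u
            refine Function.update_of_ne ?_ _ _
            rintro rfl
            exact hvS (hS inf_le_right hw)) rfl
      refine ⟨c, hc, fun w hw => ?_⟩
      rw [hcf w (Or.inr hw), Function.update_of_ne]
      rintro rfl
      exact hvS hw

/-- Tricube composition: a point `u` of the grid `{0, 1, 2}^n` is given by the set `a` of the
coordinates where `u` is `0` and the set `b` of the coordinates where it is `2`. If a map on the
grid is a cube on each of the cells around the centre, then it is a cube on `{0, 2}^n`. -/
theorem tricube (hX : X.IsNilspace) {n : ℕ} (g : Cube n → Cube n → N)
    (hg : ∀ b : Cube n, (fun u => g (u ⊓ bᶜ) (u ⊓ b)) ∈ X.cubes n) :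
    (fun u => g uᶜ u) ∈ X.cubes n := by
  -- The grid is the lower set of disjoint pairs in `{0,1}^(2n)`, and its maximal faces are the
  -- cells. After extension to all of `{0,1}^(2n)`, the subcube of complementary pairs is `{0,
  -- 2}^n`.
  let p : Cube (n + n) → Cube n := fun w i => w (Fin.castAdd n i)
  let q : Cube (n + n) → Cube n := fun w i => w (Fin.natAdd n i)
  obtain ⟨c, hc, hcg⟩ := hX.exists_extension {w : Cube (n + n) | p w ⊓ q w = ⊥}
    (by
      intro w w' hle hw
      refine le_bot_iff.1 (hw ▸ inf_le_inf ?_ ?_) <;> exact fun i => hle _)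
    (fun w => g (p w) (q w)) (by
      intro w hw
      have h1 : ∀ i, p w i = true → q w i = false := fun i h => by
        have := congrFun hw i
        simpa [h] using this
      have := X.comp_coord_mem (hg (q w))
        (fun (u : Cube (n + n)) i => (p u i && p w i) || (q u i && q w i)) (fun i => by
          cases hq : q w i
          · cases hp : p w i
            · exact Or.inl ⟨false, by simp⟩
            · exact Or.inr (Or.inl ⟨Fin.castAdd n i, by simp [p]⟩)
          · have hp : p w i = false := by
              by_contra h
              simp [h1 i (by simpa using h)] at hq
            exact Or.inr (Or.inl ⟨Fin.natAdd n i, by simp [hp, q]⟩))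
      convert this using 3 with u u
      · funext i
        have := h1 i
        simp only [p, q, Pi.inf_apply, Pi.compl_apply] at this ⊢
        cases h2 : w (Fin.castAdd n i) <;> cases h3 : w (Fin.natAdd n i) <;> simp_all
      · funext i
        have := h1 i
        simp only [p, q, Pi.inf_apply] at this ⊢
        cases h2 : w (Fin.castAdd n i) <;> cases h3 : w (Fin.natAdd n i) <;> simp_all)
  have := X.comp_coord_mem hc (fun u : Cube n => Fin.append (α := Bool) uᶜ u) (fun i => by
    induction i using Fin.addCases with
    | left i => exact Or.inr (Or.inr ⟨i, by simp⟩)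
    | right i => exact Or.inr (Or.inl ⟨i, fun v => Fin.append_right _ v i⟩))
  convert this using 2 with u
  have h1 : p (Fin.append (α := Bool) uᶜ u) = uᶜ := by funext i; simp [p]
  have h2 : q (Fin.append (α := Bool) uᶜ u) = u := by funext i; exact Fin.append_right _ u i
  rw [hcg _ (by simp [h1, h2]), h1, h2]

end Cubespace.IsNilspace

/-! ### The relations `Rel` and `EdgeRel` -/

/-- `x` and `y` are related if the map with value `y` at `1^n` and `x` elsewhere is a cube. -/
def Cubespace.Rel {N : Type*} (X : Cubespace N) (n : ℕ) (x y : N) : Prop :=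
  (fun v : Cube n => if v = ⊤ then y else x) ∈ X.cubes n

/-- The edge of `{0,1}^n` in direction `i` through `1^n`. -/
def Cube.OnEdge {n : ℕ} (i : Fin n) (v : Cube n) : Prop := ∀ l, l ≠ i → v l = true

instance {n : ℕ} (i : Fin n) : DecidablePred (Cube.OnEdge i) := fun v => by
  unfold Cube.OnEdge
  infer_instance

theorem Cube.onEdge_update {n : ℕ} {i : Fin n} {v : Cube n} {t : Bool} :
    Cube.OnEdge i (Function.update v i t) ↔ Cube.OnEdge i v := by
  refine forall₂_congr fun l hl => ?_
  rw [Function.update_of_ne hl]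

/-- The map with values `x` and `y` at the ends of the edge in direction `i` through `1^n`, and
`a`, `b` on the rest of the two faces orthogonal to this direction, is a cube. -/
def Cubespace.EdgeRel {N : Type*} (X : Cubespace N) {n : ℕ} (i : Fin n) (a x b y : N) : Prop :=
  (fun v : Cube n => if Cube.OnEdge i v then (if v i then y else x) else (if v i then b else a))
    ∈ X.cubes n

theorem Cubespace.update_mem (X : Cubespace N) {n : ℕ} {f : Cube n → N} (hf : f ∈ X.cubes n)
    (i : Fin n) (b : Cube n) :
    (fun u => f (Function.update u i (!u i || b i))) ∈ X.cubes n := by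
  refine X.comp_coord_mem hf _ fun l => ?_
  by_cases hl : l = i
  · subst hl
    cases hb : b l
    · exact Or.inr (Or.inr ⟨l, by simp⟩)
    · exact Or.inl ⟨true, by simp⟩
  · exact Or.inr (Or.inl ⟨l, by simp [hl]⟩)

/-- This is the face of `f` above `b`, read backwards. It fills the cell `b` in tricube arguments:
the centre carries `f ⊤` and the outer corner `f b`. -/
theorem Cubespace.compl_sup_mem (X : Cubespace N) {n : ℕ} {f : Cube n → N} (hf : f ∈ X.cubes n)
    (b : Cube n) : (fun u => f (uᶜ ⊔ b)) ∈ X.cubes n := by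
  refine X.comp_coord_mem hf _ fun l => ?_
  cases hb : b l
  · exact Or.inr (Or.inr ⟨l, by simp [hb]⟩)
  · exact Or.inl ⟨true, by simp [hb]⟩

namespace Cubespace.IsNilspace

/-- In `tricube`, the cell `b = ⊤` carries the cube of `Rel`, and every other cell a reflected face
of `c`. -/
theorem ite_top_mem (hX : X.IsNilspace) {n : ℕ} {c : Cube n → N} (hc : c ∈ X.cubes n) {y : N}
    (h : X.Rel n (c ⊤) y) : (fun v => if v = ⊤ then y else c v) ∈ X.cubes n := by
  have := hX.tricube (fun a b => if b = ⊤ then y else c aᶜ) (fun b => by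
    by_cases hb : b = ⊤
    · subst hb
      simpa [Rel] using h
    · have h1 : ∀ u : Cube n, u ⊓ b ≠ ⊤ := fun u hu => hb (inf_eq_top_iff.1 hu).2
      simpa [h1] using X.compl_sup_mem hc b)
  simpa using this

/-- All vertices are changed at once: `ite_top_mem` alters the outer corner of every cell. -/
theorem mem_of_rel (hX : X.IsNilspace) {n : ℕ} {c c' : Cube n → N} (hc : c ∈ X.cubes n)
    (h : ∀ v, X.Rel n (c v) (c' v)) : c' ∈ X.cubes n := by
  have := hX.tricube (fun a b => if a ⊔ b = ⊤ then c' b else c aᶜ) (fun b => by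
    have := hX.ite_top_mem (X.compl_sup_mem hc b) (y := c' b) (by simpa using h b)
    convert this using 2 with u
    have : u ⊓ bᶜ ⊔ u ⊓ b = u := by rw [sup_comm, sup_inf_inf_compl]
    rw [this]
    by_cases hu : u = ⊤
    · simp [hu]
    · simp [hu])
  simpa using this

/-- Every cell carries `c` with its top vertex outermost, except that the last one carries `c'`. The
outer corners then all read `c ⊤`, apart from one `c' ⊤`. -/
theorem rel_of_eqOn (hX : X.IsNilspace) {n : ℕ} {c c' : Cube n → N} (hc : c ∈ X.cubes n)
    (hc' : c' ∈ X.cubes n) (h : ∀ v, v ≠ ⊤ → c' v = c v) : X.Rel n (c ⊤) (c' ⊤) := by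
  have := hX.tricube (fun a b => if b = ⊤ then c' ⊤ else c (a ⊔ b)) (fun b => by
    by_cases hb : b = ⊤
    · subst hb
      convert hc' using 2 with u
      by_cases hu : u = ⊤
      · simp [hu]
      · simp [hu, h u hu]
    · have h1 : ∀ u : Cube n, u ⊓ b ≠ ⊤ := fun u hu => hb (inf_eq_top_iff.1 hu).2
      have h2 : ∀ u : Cube n, u ⊓ bᶜ ⊔ u ⊓ b = u := fun u => by
        rw [sup_comm, sup_inf_inf_compl]
      simpa [h1, h2] using hc)
  simpa [Rel] using this

theorem rel_refl (hX : X.IsNilspace) (n : ℕ) (x : N) : X.Rel n x x := by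
  simpa [Rel] using hX.const_mem n x

theorem rel_trans (hX : X.IsNilspace) {n : ℕ} {x y z : N} (h : X.Rel n x y) (h' : X.Rel n y z) :
    X.Rel n x z := by
  have := hX.ite_top_mem h (y := z) (by simpa using h')
  unfold Rel
  convert this using 2 with v
  by_cases hv : v = ⊤ <;> simp [hv]

theorem rel_symm (hX : X.IsNilspace) {n : ℕ} {x y : N} (h : X.Rel n x y) : X.Rel n y x := by
  refine hX.mem_of_rel (hX.const_mem n x) fun v => ?_
  by_cases hv : v = ⊤
  · simpa [hv] using hX.rel_refl n x
  · simpa [hv] using h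

theorem rel_of_rel_succ {n : ℕ} {x y : N} (h : X.Rel (n + 1) x y) : X.Rel n x y := by
  have := X.comp_coord_mem h (fun v : Cube n => Fin.cons (α := fun _ => Bool) true v) (fun i => by
    induction i using Fin.cases with
    | zero => exact Or.inl ⟨true, by simp⟩
    | succ i => exact Or.inr (Or.inl ⟨i, by simp⟩))
  unfold Rel
  convert this using 3 with v
  simp [funext_iff, Fin.forall_fin_succ]

theorem rel_one (hX : X.IsNilspace) (x y : N) : X.Rel 1 x y := by
  rw [Rel, hX.ergodic]
  trivial

/-- The setoid of the relation `Rel n`. -/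
def setoid (hX : X.IsNilspace) (n : ℕ) : Setoid N where
  r := X.Rel n
  iseqv := ⟨hX.rel_refl n, hX.rel_symm, hX.rel_trans⟩

/-! ### The edge relation as equality of differences -/

theorem ite_onEdge_mem (hX : X.IsNilspace) {n : ℕ} {i : Fin n} {c : Cube n → N}
    (hc : c ∈ X.cubes n) {x y : N}
    (h : X.EdgeRel i (c (Function.update ⊤ i false)) x (c ⊤) y) :
    (fun v => if Cube.OnEdge i v then (if v i then y else x) else c v) ∈ X.cubes n := by
  have := hX.tricube
    (fun a b => if Cube.OnEdge i b then (if !a i then y else x) else c aᶜ) (fun b => by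
    by_cases hb : Cube.OnEdge i b
    · convert X.update_mem h i b using 2 with u
      have h1 : Cube.OnEdge i (u ⊓ b) ↔ Cube.OnEdge i u :=
        forall₂_congr fun l hl => by simp [hb l hl]
      have h2 : (u ⊓ bᶜ)ᶜ = Function.update ⊤ i (!u i || b i) := by
        funext l
        by_cases hl : l = i
        · subst hl
          simp
        · simp [hl, hb l hl]
      simp only [h1, h2, Cube.onEdge_update]
      have h3 : Function.update (⊤ : Cube n) i true = ⊤ := by simp
      cases h4 : u i <;> cases h5 : b i <;> simp [h3, h4, h5]
    · have h1 : ∀ u : Cube n, ¬ Cube.OnEdge i (u ⊓ b) := fun u hu => hb fun l hl => by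
        have := hu l hl
        simp at this
        exact this.2
      simpa [h1] using X.compl_sup_mem hc b)
  simpa using this

theorem edgeRel_of_mem (hX : X.IsNilspace) {n : ℕ} {i : Fin n} {c : Cube n → N}
    (hc : c ∈ X.cubes n) {x y : N}
    (h : (fun v => if Cube.OnEdge i v then (if v i then y else x) else c v) ∈ X.cubes n) :
    X.EdgeRel i (c (Function.update ⊤ i false)) x (c ⊤) y := by
  have := hX.tricube (fun a b => if Cube.OnEdge i b then (if !a i then y else x) else
      c (Function.update (a ⊔ b) i (!a i))) (fun b => by
    have h2 : ∀ u : Cube n, u ⊓ bᶜ ⊔ u ⊓ b = u := fun u => by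
      rw [sup_comm, sup_inf_inf_compl]
    by_cases hb : Cube.OnEdge i b
    · convert X.update_mem h i b using 2 with u
      have h1 : Cube.OnEdge i (u ⊓ b) ↔ Cube.OnEdge i u :=
        forall₂_congr fun l hl => by simp [hb l hl]
      simp only [h1, Cube.onEdge_update, h2]
      simp
    · have h1 : ∀ u : Cube n, ¬ Cube.OnEdge i (u ⊓ b) := fun u hu => hb fun l hl => by
        have := hu l hl
        simp at this
        exact this.2
      simpa [h1, h2] using X.update_mem hc i b)
  unfold EdgeRel
  convert this using 2 with u
  have h3 : Function.update (⊤ : Cube n) i true = ⊤ := by simp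
  cases h4 : u i <;> simp [h4, h3]

/-- In group terms, both ends of each edge in direction `i` may be shifted by a common amount, which
can vary from edge to edge. This allows cubes to be differenced one coordinate at a time. -/
theorem mem_of_edgeRel (hX : X.IsNilspace) {n : ℕ} (i : Fin n) {c c' : Cube n → N}
    (hc : c ∈ X.cubes n)
    (h : ∀ w, X.EdgeRel i (c (Function.update w i false)) (c' (Function.update w i false))
      (c (Function.update w i true)) (c' (Function.update w i true))) : c' ∈ X.cubes n := by
  have := hX.tricube (fun a b => if Cube.OnEdge i (a ⊔ b) then c' (Function.update b i (!a i))
      else c aᶜ) (fun b => by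
    have hd : (fun u => c (Function.update (uᶜ ⊔ b) i (u i))) ∈ X.cubes n := by
      refine X.comp_coord_mem hc _ fun l => ?_
      by_cases hl : l = i
      · subst hl
        exact Or.inr (Or.inl ⟨l, by simp⟩)
      · cases hb : b l
        · exact Or.inr (Or.inr ⟨l, by simp [hb, hl]⟩)
        · exact Or.inl ⟨true, by simp [hb, hl]⟩
    have h1 : Function.update ((Function.update (⊤ : Cube n) i false)ᶜ ⊔ b) i false
        = Function.update b i false := by
      funext l
      by_cases hl : l = i
      · subst hl
        simp
      · simp [hl]
    have := X.update_mem (hX.ite_onEdge_mem hd (i := i)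
      (x := c' (Function.update b i false)) (y := c' (Function.update b i true))
      (by simpa [h1] using h b)) i b
    convert this using 2 with u
    have h2 : u ⊓ bᶜ ⊔ u ⊓ b = u := by rw [sup_comm, sup_inf_inf_compl]
    simp only [h2, Cube.onEdge_update]
    by_cases hu : Cube.OnEdge i u
    · have h3 : Function.update (u ⊓ b) i = Function.update b i := by
        funext t l
        by_cases hl : l = i
        · subst hl
          simp
        · simp [hl, hu l hl]
      rw [if_pos hu, if_pos hu, h3]
      cases h4 : u i <;> cases h5 : b i <;> simp [h4, h5]
    · rw [if_neg hu, if_neg hu]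
      congr 1
      funext l
      by_cases hl : l = i
      · subst hl
        simp
      · simp [hl])
  convert this using 2 with u
  have hu : Cube.OnEdge i (⊤ : Cube n) := fun l _ => rfl
  simp [hu]

theorem edgeRel_symm {n : ℕ} {i : Fin n} {a x b y : N} (h : X.EdgeRel i a x b y) :
    X.EdgeRel i b y a x := by
  unfold EdgeRel
  convert X.update_mem h i ⊥ using 2 with u
  simp only [Cube.onEdge_update]
  cases hu : u i <;> simp

/-- The two cubes are stacked along direction `i` across the common face with values `b`, `y`, which
lies in the middle of the grid. -/
theorem edgeRel_trans (hX : X.IsNilspace) {n : ℕ} {i : Fin n} {a x b y c z : N}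
    (h : X.EdgeRel i a x b y) (h' : X.EdgeRel i b y c z) : X.EdgeRel i a x c z := by
  have := hX.tricube (fun α β => if α i then (if Cube.OnEdge i αᶜ then x else a) else
      if β i then (if Cube.OnEdge i αᶜ then z else c) else
        (if Cube.OnEdge i αᶜ then y else b)) (fun β => by
    have key : ∀ t : Bool, ∀ {f : Cube n → N}, f ∈ X.cubes n →
        (fun u => f (Function.update (uᶜ ⊔ β) i (xor t (u i)))) ∈ X.cubes n := by
      intro t f hf
      refine X.comp_coord_mem hf _ fun l => ?_
      by_cases hl : l = i
      · subst hl
        cases t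
        · exact Or.inr (Or.inl ⟨l, by simp⟩)
        · exact Or.inr (Or.inr ⟨l, by simp⟩)
      · cases hb : β l
        · exact Or.inr (Or.inr ⟨l, by simp [hb, hl]⟩)
        · exact Or.inl ⟨true, by simp [hb, hl]⟩
    cases hβ : β i
    · convert key true h using 2 with u
      simp only [Cube.onEdge_update]
      cases hu : u i <;> simp [hu, hβ]
    · convert key false h' using 2 with u
      simp only [Cube.onEdge_update]
      cases hu : u i <;> simp [hu, hβ])
  unfold EdgeRel
  convert this using 2 with u
  cases hu : u i <;> simp [hu]

theorem edgeRel_refl {k : ℕ} {a b : N} (h : X.Rel (k + 1) a b) :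
    X.EdgeRel (0 : Fin (k + 2)) a b a b := by
  unfold EdgeRel
  convert X.comp_coord_mem h (fun (v : Cube (k + 2)) i => v i.succ)
    (fun i => Or.inr (Or.inl ⟨i.succ, by simp⟩)) using 2 with v
  simp [Cube.OnEdge, funext_iff, Fin.forall_fin_succ]

theorem edgeRel_congr (hX : X.IsNilspace) {n : ℕ} {i : Fin n} {a x b y a' x' b' y' : N}
    (h : X.EdgeRel i a x b y) (ha : X.Rel n a a') (hx : X.Rel n x x') (hb : X.Rel n b b')
    (hy : X.Rel n y y') : X.EdgeRel i a' x' b' y' := by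
  refine hX.mem_of_rel h fun v => ?_
  split_ifs <;> assumption

theorem edgeRel_direction {n : ℕ} (i j : Fin n) {a x b y : N} (h : X.EdgeRel i a x b y) :
    X.EdgeRel j a x b y := by
  unfold EdgeRel
  convert X.comp_coord_mem h (fun v l => v (Equiv.swap i j l))
    (fun l => Or.inr (Or.inl ⟨_, fun _ => rfl⟩)) using 2 with v
  have : Cube.OnEdge i (fun l => v (Equiv.swap i j l)) ↔ Cube.OnEdge j v := by
    constructor
    · intro h l hl
      have := h (Equiv.swap i j l) (fun h => hl (by
        rw [Equiv.swap_apply_eq_iff] at h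
        simpa using h))
      simpa using this
    · intro h l hl
      exact h _ fun h' => hl (by
        rw [Equiv.swap_apply_eq_iff] at h'
        simpa using h')
  simp only [this, Equiv.swap_apply_left]

theorem edgeRel_transpose (hX : X.IsNilspace) {k : ℕ} {a b c d : N} (hb : X.Rel (k + 1) a b)
    (hc : X.Rel (k + 1) a c) (h : X.EdgeRel (0 : Fin (k + 2)) a b c d) :
    X.EdgeRel (0 : Fin (k + 2)) a c b d := by
  have key : ∀ c, X.Rel (k + 1) a c → (fun v : Cube (k + 2) =>
      if v 0 ∧ ∀ l : Fin k, v l.succ.succ = true then c else a) ∈ X.cubes (k + 2) := by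
    intro c hc
    have h1 : (fun v : Cube (k + 1) => if v = ⊤ then c else a) ∈ X.cubes (k + 1) := hc
    convert X.comp_coord_mem h1
      (fun (v : Cube (k + 2)) => Fin.cons (α := fun _ => Bool) (v 0) fun l => v l.succ.succ)
      (fun i => ?_) using 2 with v
    · simp [funext_iff, Fin.forall_fin_succ]
    · induction i using Fin.cases with
      | zero => exact Or.inr (Or.inl ⟨0, by simp⟩)
      | succ i => exact Or.inr (Or.inl ⟨i.succ.succ, by simp⟩)
  -- This cube has the values `a, b, c, d` on the square in directions `0` and `1` through `⊤`, and
  -- `a` elsewhere. Exchanging the two directions exchanges `b` and `c`.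
  have h1 := hX.ite_onEdge_mem (i := 0) (key c hc) (x := b) (y := d) (by simpa using h)
  have h2 := hX.edgeRel_of_mem (i := 0) (key b hb) (x := c) (y := d) (by
    convert X.comp_coord_mem h1 (fun v l => v (Equiv.swap 0 1 l))
      (fun l => Or.inr (Or.inl ⟨_, fun _ => rfl⟩)) using 2 with v
    have h3 : ∀ l : Fin k, Equiv.swap (0 : Fin (k + 2)) 1 l.succ.succ = l.succ.succ := fun l =>
      Equiv.swap_apply_of_ne_of_ne (Fin.succ_ne_zero _)
        (fun h => Fin.succ_ne_zero l (Fin.succ_injective _ h))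
    by_cases hl : ∀ l : Fin k, v l.succ.succ = true
    · cases h4 : v 0 <;> cases h5 : v 1 <;>
        simp [Cube.OnEdge, Fin.forall_fin_succ, h3, hl, h4, h5]
    · simp [Cube.OnEdge, Fin.forall_fin_succ, h3, hl])
  simpa using h2

theorem exists_edgeRel (hX : X.IsNilspace) {k : ℕ} {a b : N} (c : N) (h : X.Rel (k + 1) a b) :
    ∃ d, X.EdgeRel (0 : Fin (k + 2)) a b c d := by
  obtain ⟨f, hf, hfe⟩ := hX.gluing (k + 1)
    (fun v : Cube (k + 2) => if Cube.OnEdge 0 v then b else (if v 0 then c else a)) (by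
      intro i
      induction i using Fin.cases with
      | zero =>
        unfold Rel at h
        convert h using 2 with v
        simp [Cube.OnEdge, Fin.forall_fin_succ, funext_iff]
      | succ i =>
        convert hX.ite_coord_mem (0 : Fin (k + 1)) a c using 2 with v
        have h0 := Fin.insertNth_apply_succAbove (α := fun _ => Bool) i.succ false v 0
        rw [Fin.succ_succAbove_zero] at h0
        have he : ¬ Cube.OnEdge 0 (i.succ.insertNth (α := fun _ => Bool) false v) := fun he => by
          simpa using he i.succ (Fin.succ_ne_zero _)
        simp only [if_neg he, h0])
  refine ⟨f ⊤, ?_⟩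
  unfold EdgeRel
  convert hf using 2 with v
  by_cases hv : v = ⊤
  · subst hv
    simp [Cube.OnEdge]
  · rw [hfe v hv]
    dsimp only
    by_cases he : Cube.OnEdge 0 v
    · rw [if_pos he, if_pos he, if_neg]
      intro h0
      refine hv (funext fun l => ?_)
      by_cases hl : l = 0
      · simpa [hl] using h0
      · simpa using he l hl
    · rw [if_neg he, if_neg he]

theorem rel_of_edgeRel {k : ℕ} {a b c d : N} (h : X.EdgeRel (0 : Fin (k + 2)) a b c d) :
    X.Rel (k + 1) c d := by
  unfold Rel
  convert X.comp_coord_mem h (fun v : Cube (k + 1) => Fin.cons (α := fun _ => Bool) true v)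
    (fun i => ?_) using 2 with v
  · simp [Cube.OnEdge, Fin.forall_fin_succ, funext_iff]
  · induction i using Fin.cases with
    | zero => exact Or.inl ⟨true, by simp⟩
    | succ i => exact Or.inr (Or.inl ⟨i, by simp⟩)

theorem edgeRel_unique (hX : X.IsNilspace) {n : ℕ} {i : Fin n} {a b c d d' : N}
    (h : X.EdgeRel i a b c d) (h' : X.EdgeRel i a b c d') : X.Rel n d d' := by
  have := hX.rel_of_eqOn h h' (fun v hv => by
    by_cases he : Cube.OnEdge i v
    · have : v i = false := by
        by_contra h0
        refine hv (funext fun l => ?_)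
        by_cases hl : l = i
        · simpa [hl] using h0
        · simpa using he l hl
      simp [this]
    · simp [he])
  simpa [Cube.OnEdge] using this

end Cubespace.IsNilspace

/-! ### Groups from difference relations, and periodicity of polynomial maps -/

/-- A quaternary relation with the properties of `b - a = d - c` comes from a group structure. -/
theorem exists_addCommGroup {Q : Type*} (e : Q) (S : Q → Q → Q → Q → Prop)
    (refl : ∀ a b, S a b a b) (symm : ∀ {a b c d}, S a b c d → S c d a b)
    (trans : ∀ {a b c d x y}, S a b c d → S c d x y → S a b x y)
    (transp : ∀ {a b c d}, S a b c d → S a c b d) (ex : ∀ a b c, ∃ d, S a b c d)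
    (uniq : ∀ {a b c d d'}, S a b c d → S a b c d' → d = d') :
    ∃ _ : AddCommGroup Q, ∀ a b c d, S a b c d ↔ b - a = d - c := by
  -- `p a b c` plays the role of `b - a + c`; with `e` as zero, the sum is `p e a b` and the
  -- negative is `p a e e`.
  choose p hp using ex
  have comm : ∀ a b, p e a b = p e b a := fun a b => uniq (transp (hp e a b)) (hp e b a)
  have assoc : ∀ a b c, p e (p e a b) c = p e a (p e b c) := by
    intro a b c
    have h1 := transp (trans (symm (hp e a b)) (hp e a (p e b c)))
    have h2 : S e c b (p e b c) := by
      rw [comm]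
      exact hp e c b
    rw [comm, uniq (hp e c (p e a b)) (trans h2 h1)]
  let : Zero Q := ⟨e⟩
  let : Add Q := ⟨p e⟩
  let : Neg Q := ⟨fun a => p a e e⟩
  let G : AddGroup Q := AddGroup.ofLeftAxioms assoc
    (fun a => uniq (hp e e a) (transp (refl e a)))
    (fun a => uniq (hp e (p a e e) a) (symm (hp a e e)))
  refine ⟨{ G with add_comm := comm }, fun a b c d => ?_⟩
  have key : ∀ x a, S e x a (x + a) := fun x a => hp e x a
  have h1 : S e (b - a) a b := by simpa using key (b - a) a
  constructor
  · intro h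
    rw [eq_sub_iff_add_eq]
    exact uniq (key (b - a) c) (trans h1 h)
  · intro h
    rw [eq_sub_iff_add_eq] at h
    exact trans (symm h1) (h ▸ key (b - a) c)

/-- If the difference of `f` has period `h = m ^ d`, then `f (x + h) - f x` does not depend on `x`.
Adding up `m` of these equal increments gives zero. -/
theorem periodic_of_iterate_fwdDiff_eq_zero {Q : Type*} [AddCommGroup Q] {m : ℕ}
    (hm : ∀ q : Q, m • q = 0) (d : ℕ) (f : ℤ → Q) (hf : ∀ x, (fwdDiff (1 : ℤ))^[d + 1] f x = 0) :
    Function.Periodic f ((m : ℤ) ^ d) := by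
  induction d generalizing f with
  | zero =>
    intro x
    simpa [fwdDiff, sub_eq_zero] using hf x
  | succ d ih =>
    have h1 := ih (fwdDiff 1 f) fun x => by simpa using hf x
    set h : ℕ := m ^ d with hh
    have h2 : ∀ x (t : ℕ), f (x + t + h) - f (x + t) = f (x + h) - f x := by
      intro x t
      induction t with
      | zero => simp
      | succ t iht =>
        rw [← iht]
        have := h1 (x + t)
        simp only [fwdDiff, ← Nat.cast_pow, ← hh] at this
        push_cast
        rw [show x + ((t : ℤ) + 1) + h = x + t + h + 1 by ring,
          show x + ((t : ℤ) + 1) = x + t + 1 by ring]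
        rw [sub_eq_sub_iff_add_eq_add] at this ⊢
        rw [this]
        abel
    have h3 : ∀ x (t : ℕ), f (x + (t * h : ℕ)) = f x + t • (f (x + h) - f x) := by
      intro x t
      induction t with
      | zero => simp
      | succ t iht =>
        have := h2 x (t * h)
        rw [sub_eq_iff_eq_add] at this
        rw [add_mul, one_mul, Nat.cast_add, ← add_assoc, this, iht, succ_nsmul]
        abel
    intro x
    have := h3 x m
    rw [hm, add_zero, hh] at this
    rw [← this]
    push_cast
    rw [pow_succ']

/-! ### The group structure and the order of the fibres -/

namespace Cubespace.IsNilspace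

/-- The projection of the quotient by `Rel (n + 1)` to the quotient by `Rel n`. -/
def proj (hX : X.IsNilspace) (n : ℕ) :
    Quotient (hX.setoid (n + 1)) → Quotient (hX.setoid n) :=
  Quotient.map' id fun _ _ => rel_of_rel_succ

/-- The fibre of `proj`. -/
abbrev Fibre (hX : X.IsNilspace) {n : ℕ} (y : Quotient (hX.setoid n)) : Type _ :=
  {q : Quotient (hX.setoid (n + 1)) // hX.proj n q = y}

theorem mk_out_fibre (hX : X.IsNilspace) {n : ℕ} {y : Quotient (hX.setoid n)} (q : hX.Fibre y) :
    (Quotient.mk (hX.setoid n) q.1.out) = y := by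
  refine Eq.trans ?_ q.2
  conv_rhs => rw [← Quotient.out_eq q.1]
  rfl

theorem rel_out_fibre (hX : X.IsNilspace) {n : ℕ} {y : Quotient (hX.setoid n)}
    (q q' : hX.Fibre y) : X.Rel n q.1.out q'.1.out :=
  Quotient.exact (s := hX.setoid n) ((hX.mk_out_fibre q).trans (hX.mk_out_fibre q').symm)

theorem fibre_ext (hX : X.IsNilspace) {n : ℕ} {y : Quotient (hX.setoid n)} {q q' : hX.Fibre y}
    (h : X.Rel (n + 1) q.1.out q'.1.out) : q = q' := by
  refine Subtype.ext ?_
  rw [← Quotient.out_eq q.1, ← Quotient.out_eq q'.1]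
  exact Quotient.sound h

theorem out_mk_rel (hX : X.IsNilspace) (n : ℕ) (x : N) :
    X.Rel n x (Quotient.mk (hX.setoid n) x).out :=
  hX.rel_symm (Quotient.exact (s := hX.setoid n) (Quotient.out_eq _))

theorem exists_fibre_edgeRel (hX : X.IsNilspace) {k : ℕ} {y y' : Quotient (hX.setoid (k + 1))}
    (a b : hX.Fibre y) (c : hX.Fibre y') : ∃ d : hX.Fibre y',
      X.EdgeRel (0 : Fin (k + 2)) a.1.out b.1.out c.1.out d.1.out := by
  obtain ⟨d, hd⟩ := hX.exists_edgeRel c.1.out (hX.rel_out_fibre a b)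
  refine ⟨⟨Quotient.mk _ d, ?_⟩, ?_⟩
  · rw [← hX.mk_out_fibre c]
    exact Quotient.sound (s := hX.setoid (k + 1)) (hX.rel_symm (rel_of_edgeRel hd))
  · exact hX.edgeRel_congr hd (hX.rel_refl _ _) (hX.rel_refl _ _) (hX.rel_refl _ _)
      (hX.out_mk_rel _ d)

theorem nonempty_fibre (hX : X.IsNilspace) {n : ℕ} (y : Quotient (hX.setoid n)) :
    Nonempty (hX.Fibre y) := by
  induction y using Quotient.inductionOn with
  | _ x => exact ⟨⟨Quotient.mk _ x, rfl⟩⟩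

/-- Fourth terms of `EdgeRel` in dimension `k + 2` are unique only up to `Rel (k + 2)`, which is
equality in the fibre. -/
theorem exists_fibre_addCommGroup (hX : X.IsNilspace) {k : ℕ} (y : Quotient (hX.setoid (k + 1))) :
    ∃ _ : AddCommGroup (hX.Fibre y), ∀ a b c d : hX.Fibre y,
      X.EdgeRel (0 : Fin (k + 2)) a.1.out b.1.out c.1.out d.1.out ↔ b - a = d - c := by
  obtain ⟨e⟩ := hX.nonempty_fibre y
  exact exists_addCommGroup e
    (fun a b c d => X.EdgeRel (0 : Fin (k + 2)) a.1.out b.1.out c.1.out d.1.out)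
    (fun a b => edgeRel_refl (hX.rel_out_fibre a b)) edgeRel_symm hX.edgeRel_trans
    (hX.edgeRel_transpose (hX.rel_out_fibre _ _) (hX.rel_out_fibre _ _))
    hX.exists_fibre_edgeRel (fun h h' => hX.fibre_ext (hX.edgeRel_unique h h'))

/-- Transporting the difference `b - a` to the base point `c` of the other fibre is injective in
`b`. -/
theorem card_fibre_le [Finite N] (hX : X.IsNilspace) {k : ℕ}
    (y y' : Quotient (hX.setoid (k + 1))) : Nat.card (hX.Fibre y) ≤ Nat.card (hX.Fibre y') := by
  obtain ⟨a⟩ := hX.nonempty_fibre y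
  obtain ⟨c⟩ := hX.nonempty_fibre y'
  choose g hg using fun b => hX.exists_fibre_edgeRel a b c
  refine Nat.card_le_card_of_injective g fun b b' h => ?_
  have h1 := hg b'
  rw [← h] at h1
  exact hX.fibre_ext (hX.edgeRel_unique (edgeRel_symm (hg b)) (edgeRel_symm h1))

theorem card_quotient_succ [Finite N] (hX : X.IsNilspace) {k : ℕ}
    (y : Quotient (hX.setoid (k + 1))) :
    Nat.card (Quotient (hX.setoid (k + 2))) =
      Nat.card (Quotient (hX.setoid (k + 1))) * Nat.card (hX.Fibre y) := by
  classical
  have := Fintype.ofFinite (Quotient (hX.setoid (k + 1)))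
  rw [← Nat.card_congr (Equiv.sigmaFiberEquiv (hX.proj (k + 1))), Nat.card_sigma,
    Finset.sum_congr rfl fun y' _ => le_antisymm (hX.card_fibre_le y' y) (hX.card_fibre_le y y')]
  simp [Nat.card_eq_fintype_card]

end Cubespace.IsNilspace

namespace Cubespace.IsStepNilspace

/-- The cube of `Rel` and the constant cube complete the same corner. -/
theorem eq_of_rel {s : ℕ} (hX : X.IsStepNilspace s) {x y : N} (h : X.Rel (s + 1) x y) : x = y := by
  have hx := hX.toIsNilspace
  obtain ⟨c, -, hc⟩ := hX.unique_gluing (fun _ => x) fun _ => hx.const_mem s x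
  have h1 := hc (fun _ => x) ⟨hx.const_mem _ x, fun _ _ => rfl⟩
  have h2 := hc _ ⟨h, fun v hv => if_neg hv⟩
  simpa using congrFun (h1.trans h2.symm) ⊤

theorem card_quotient_dvd [Finite N] {s : ℕ} (hX : X.IsStepNilspace s) {k : ℕ} (hk : k ≤ s) :
    Nat.card (Quotient (hX.toIsNilspace.setoid (k + 1))) ∣ Nat.card N := by
  induction hk using Nat.decreasingInduction with
  | self =>
    refine (Nat.card_congr (Equiv.ofBijective (Quotient.mk _) ⟨fun x y h => ?_,
      Quotient.mk_surjective⟩)).symm.dvd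
    exact hX.eq_of_rel (Quotient.exact (s := hX.toIsNilspace.setoid (s + 1)) h)
  | of_succ k hk ih =>
    rcases isEmpty_or_nonempty (Quotient (hX.toIsNilspace.setoid (k + 1))) with h | ⟨⟨y⟩⟩
    · have : IsEmpty N := ⟨fun x => h.false (Quotient.mk _ x)⟩
      simp
    · rw [hX.toIsNilspace.card_quotient_succ y] at ih
      exact (dvd_mul_right _ _).trans ih

theorem card_fibre_dvd [Finite N] {s : ℕ} (hX : X.IsStepNilspace s) {k : ℕ} (hk : k < s)
    (y : Quotient (hX.toIsNilspace.setoid (k + 1))) :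
    Nat.card (hX.toIsNilspace.Fibre y) ∣ Nat.card N := by
  have := hX.card_quotient_dvd (k := k + 1) hk
  rw [hX.toIsNilspace.card_quotient_succ y] at this
  exact (dvd_mul_left _ _).trans this

end Cubespace.IsStepNilspace

/-! ### Vanishing differences and periodicity -/

namespace Cubespace.IsNilspace

/-- The directions in `I` have been differenced: for a new direction `i`, the value at the lower end
of each edge is subtracted from both ends. For `I` everything, only the vertex `⊤` can differ from
`0`, so the top difference is related to `0`. -/
theorem iterate_fwdDiff_mem (hX : X.IsNilspace) {k : ℕ} {y : Quotient (hX.setoid (k + 1))}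
    [AddCommGroup (hX.Fibre y)] (hG : ∀ a b c d : hX.Fibre y,
      X.EdgeRel (0 : Fin (k + 2)) a.1.out b.1.out c.1.out d.1.out ↔ b - a = d - c)
    (f : ℤ → hX.Fibre y)
    (hf : ∀ x, (fun v : Cube (k + 2) => (f (x + ∑ i, if v i then 1 else 0)).1.out) ∈
      X.cubes (k + 2)) (I : Finset (Fin (k + 2))) (x : ℤ) :
    (fun v : Cube (k + 2) => (if ∀ i ∈ I, v i = true then
      (fwdDiff 1)^[I.card] f (x + ∑ i ∈ Iᶜ, if v i then 1 else 0) else 0).1.out) ∈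
        X.cubes (k + 2) := by
  induction I using Finset.induction_on with
  | empty => simpa using hf x
  | insert i I hi ih =>
    refine hX.mem_of_edgeRel i ih fun w => edgeRel_direction 0 i ((hG _ _ _ _).2 ?_)
    have h1 : Iᶜ = insert i (insert i I)ᶜ := by
      ext l
      by_cases hl : l = i
      · simp [hl, hi]
      · simp [hl]
    have h2 : ∀ t, (∀ l ∈ I, Function.update w i t l = true) ↔ ∀ l ∈ I, w l = true := fun t =>
      forall₂_congr fun l hl => by
        rw [Function.update_of_ne]
        rintro rfl
        exact hi hl
    have h3 : ∀ t, (∑ l ∈ (insert i I)ᶜ, if Function.update w i t l = true then (1 : ℤ) else 0) =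
        ∑ l ∈ (insert i I)ᶜ, if w l = true then 1 else 0 := fun t =>
      Finset.sum_congr rfl fun l hl => by
        rw [Function.update_of_ne]
        rintro rfl
        simp at hl
    rw [h1, Finset.card_insert_of_notMem hi]
    simp only [Finset.forall_mem_insert, h2, Function.update_self]
    rw [Finset.sum_insert (by simp), Finset.sum_insert (by simp), h3, h3]
    by_cases hI : ∀ l ∈ I, w l = true
    · simp only [Function.iterate_succ_apply', fwdDiff]
      generalize ∑ l ∈ (insert i I)ᶜ, (if w l = true then (1 : ℤ) else 0) = t
      simp only [Function.update_self, Bool.false_eq_true, false_and, true_and, if_false, if_true, if_pos hI, zero_add]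
      rw [show x + (1 + t) = x + t + 1 by ring]
      abel
    · simp [hI]

theorem iterate_fwdDiff_eq_zero (hX : X.IsNilspace) {k : ℕ} {y : Quotient (hX.setoid (k + 1))}
    [AddCommGroup (hX.Fibre y)] (hG : ∀ a b c d : hX.Fibre y,
      X.EdgeRel (0 : Fin (k + 2)) a.1.out b.1.out c.1.out d.1.out ↔ b - a = d - c)
    (f : ℤ → hX.Fibre y)
    (hf : ∀ x, (fun v : Cube (k + 2) => (f (x + ∑ i, if v i then 1 else 0)).1.out) ∈
      X.cubes (k + 2)) (x : ℤ) : (fwdDiff 1)^[k + 2] f x = 0 := by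
  have := hX.iterate_fwdDiff_mem hG f hf Finset.univ x
  refine hX.fibre_ext (hX.rel_symm ?_)
  unfold Rel
  convert this using 2 with v
  have h : v = ⊤ ↔ ∀ i ∈ Finset.univ, v i = true := by simp [funext_iff]
  simp only [← h]
  by_cases hv : v = ⊤ <;> simp [hv]

theorem rel_mul_pow [Finite N] (hX : X.IsNilspace) {k m : ℕ} (ψ : ℤ → N)
    (hψ : ∀ x, (fun v : Cube (k + 2) => ψ (x + ∑ i, if v i then 1 else 0)) ∈ X.cubes (k + 2))
    (hm : ∀ y : Quotient (hX.setoid (k + 1)), Nat.card (hX.Fibre y) ∣ m)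
    (hrel : ∀ x, X.Rel (k + 1) (ψ 0) (ψ x)) (x : ℤ) :
    X.Rel (k + 2) (ψ 0) (ψ (m ^ (k + 1) * x)) := by
  let y := Quotient.mk (hX.setoid (k + 1)) (ψ 0)
  obtain ⟨_, hG⟩ := hX.exists_fibre_addCommGroup y
  let f : ℤ → hX.Fibre y := fun x => ⟨Quotient.mk _ (ψ x),
    Quotient.sound (s := hX.setoid (k + 1)) (hX.rel_symm (hrel x))⟩
  have hf := hX.iterate_fwdDiff_eq_zero hG f fun x =>
    hX.mem_of_rel (hψ x) fun v => hX.out_mk_rel _ _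
  have hper := periodic_of_iterate_fwdDiff_eq_zero (m := m) (fun q => by
    obtain ⟨t, ht⟩ := hm y
    rw [ht, mul_comm, mul_nsmul', card_nsmul_eq_zero', nsmul_zero]) (k + 1) f hf
  have := hper.int_mul x 0
  rw [zero_add, mul_comm] at this
  exact Quotient.exact (s := hX.setoid (k + 2)) (congrArg Subtype.val this).symm

end Cubespace.IsNilspace

/-- Arbitrary steps `h` are allowed so that the hypothesis survives the restriction of `ψ` to a
progression. -/
theorem Cubespace.IsStepNilspace.exists_periodic [Finite N] {s : ℕ} (hX : X.IsStepNilspace s) :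
    ∃ α : ℕ, ∀ ψ : ℤ → N, (∀ (n : ℕ) (x h : ℤ),
      (fun v : Cube n => ψ (x + h * ∑ i, if v i then 1 else 0)) ∈ X.cubes n) →
        Function.Periodic ψ ((Nat.card N : ℤ) ^ α) := by
  have hx := hX.toIsNilspace
  have key : ∀ k ≤ s, ∃ α : ℕ, ∀ ψ : ℤ → N, (∀ (n : ℕ) (x h : ℤ),
      (fun v : Cube n => ψ (x + h * ∑ i, if v i then 1 else 0)) ∈ X.cubes n) →
        ∀ x, X.Rel (k + 1) (ψ 0) (ψ ((Nat.card N : ℤ) ^ α * x)) := by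
    intro k hk
    induction k with
    | zero => exact ⟨0, fun ψ _ x => hx.rel_one _ _⟩
    | succ k ih =>
      obtain ⟨α, hα⟩ := ih (by omega)
      refine ⟨α + (k + 1), fun ψ hψ x => ?_⟩
      have := hx.rel_mul_pow (k := k) (m := Nat.card N)
        (fun x => ψ ((Nat.card N : ℤ) ^ α * x))
        (fun x => by
          convert hψ (k + 2) ((Nat.card N : ℤ) ^ α * x) ((Nat.card N : ℤ) ^ α) using 3 with v
          ring)
        (fun y => hX.card_fibre_dvd (by omega) y)
        (fun x => by simpa using hα ψ hψ x) x
      simpa [pow_add, mul_assoc] using this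
  obtain ⟨α, hα⟩ := key s le_rfl
  refine ⟨α, fun ψ hψ a => ?_⟩
  -- The inductive claim compares values with that at `0` only; translating `ψ` by `a` gives the
  -- period at `a`.
  have := hX.eq_of_rel (hα (fun x => ψ (a + x)) (fun n x h => by
    simpa [add_assoc] using hψ n (a + x) h) 1)
  simpa using this.symm


/-! ### Degree structures: affine cubes and lifting -/

/-- The alternating sum over a cube is a difference of alternating sums over two faces. -/
theorem alternatingSum_insertNth {A : Type*} [AddCommGroup A] {n : ℕ} (k : Fin (n + 1))
    (f : Cube (n + 1) → A) :
    ∑ v : Cube (n + 1), (-1 : ℤ) ^ v.height • f v =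
      (∑ v : Cube n, (-1 : ℤ) ^ v.height • f (k.insertNth (α := fun _ => Bool) false v)) -
        ∑ v : Cube n, (-1 : ℤ) ^ v.height • f (k.insertNth (α := fun _ => Bool) true v) := by
  rw [← (Fin.insertNthEquiv (fun _ => Bool) k).sum_comp, Fintype.sum_prod_type,
    Fintype.sum_bool, add_comm, sub_eq_add_neg, ← Finset.sum_neg_distrib]
  have h : ∀ (b : Bool) (v : Cube n), Cube.height (k.insertNth (α := fun _ => Bool) b v) =
      (if b then 1 else 0) + v.height := fun b v => by
    simp [Cube.height, Fin.sum_univ_succAbove _ k]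
  have he : ∀ (b : Bool) (v : Cube n),
      Fin.insertNthEquiv (fun _ => Bool) k (b, v) = k.insertNth (α := fun _ => Bool) b v :=
    fun _ _ => rfl
  simp [he, h, pow_add]

theorem alternatingSum_eq_zero {A : Type*} [AddCommGroup A] {n : ℕ} (k : Fin (n + 1))
    (f : Cube (n + 1) → A) (hf : ∀ v b, f (Function.update v k b) = f v) :
    ∑ v : Cube (n + 1), (-1 : ℤ) ^ v.height • f v = 0 := by
  rw [alternatingSum_insertNth k, sub_eq_zero]
  refine Finset.sum_congr rfl fun v _ => ?_
  rw [← hf (k.insertNth (α := fun _ => Bool) true v) false]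
  simp

theorem const_mem_degreeSpace {A : Type*} [AddCommGroup A] (i n : ℕ) (a : A) :
    (fun _ => a) ∈ (degreeSpace i A).cubes n := fun _ _ =>
  alternatingSum_eq_zero 0 _ fun _ _ => rfl

theorem add_mem_degreeSpace {A : Type*} [AddCommGroup A] {i n : ℕ} {f g : Cube n → A}
    (hf : f ∈ (degreeSpace i A).cubes n) (hg : g ∈ (degreeSpace i A).cubes n) :
    f + g ∈ (degreeSpace i A).cubes n := fun φ hφ => by
  simp [smul_add, Finset.sum_add_distrib, hf φ hφ, hg φ hφ]

theorem map_mem_degreeSpace {A B : Type*} [AddCommGroup A] [AddCommGroup B] (p : A →+ B)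
    {i n : ℕ} {f : Cube n → A} (hf : f ∈ (degreeSpace i A).cubes n) :
    (fun v => p (f v)) ∈ (degreeSpace i B).cubes n := fun φ hφ => by
  have := congrArg p (hf φ hφ)
  rw [map_sum, map_zero] at this
  simpa only [map_zsmul] using this

theorem affine_mem_degreeSpace (n : ℕ) (i : ℕ) (x h : ℤ) :
    (fun v : Cube n => x + h * ∑ i, if v i then 1 else 0) ∈ (degreeSpace (i + 1) ℤ).cubes n := by
  rintro φ ⟨L, b, hL⟩
  let M : (Fin (i + 2) → ℤ) →+ ℤ :=
    (∑ j, Pi.evalAddMonoidHom (fun _ => ℤ) j : (Fin n → ℤ) →+ ℤ).comp L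
  have h1 : ∀ v, (∑ j, if φ v j then (1 : ℤ) else 0) =
      (∑ k, if v k then M (Pi.single k 1) else 0) + ∑ j, b j := by
    intro v
    have h2 : M v.toInt = ∑ k, if v k then M (Pi.single k 1) else 0 := by
      conv_lhs => rw [← Finset.univ_sum_single v.toInt, map_sum]
      refine Finset.sum_congr rfl fun k _ => ?_
      cases hv : v k <;> simp [Cube.toInt, hv]
    have h3 : ∀ j, (if φ v j then (1 : ℤ) else 0) = L v.toInt j + b j := fun j =>
      congrFun (hL v) j
    rw [← h2, Finset.sum_congr rfl fun j _ => h3 j, Finset.sum_add_distrib]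
    simp [M]
  simp only [h1, mul_add, smul_add, Finset.sum_add_distrib]
  rw [alternatingSum_eq_zero 0 (fun _ => x) (fun _ _ => rfl),
    alternatingSum_eq_zero 0 (fun _ => h * ∑ j, b j) (fun _ _ => rfl)]
  simp only [Finset.mul_sum, Finset.smul_sum]
  rw [Finset.sum_comm]
  simp only [zero_add, add_zero]
  refine Finset.sum_eq_zero fun k _ => ?_
  -- The cube has dimension `i + 2 ≥ 2`, so each summand, which depends on coordinate `k` alone,
  -- ignores some other coordinate.
  obtain ⟨l, hl⟩ := exists_ne k
  exact alternatingSum_eq_zero l (fun v => h * if v k then M (Pi.single k 1) else 0)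
    fun v b => by rw [Function.update_of_ne hl.symm]

theorem IsMorphism.affine_mem {N : Type*} {X : Cubespace N} {i : ℕ} {φ : ℤ → N}
    (hφ : IsMorphism (degreeSpace (i + 1) ℤ) X φ) (n : ℕ) (x h : ℤ) :
    (fun v : Cube n => φ (x + h * ∑ i, if v i then 1 else 0)) ∈ X.cubes n :=
  hφ n _ (affine_mem_degreeSpace n i x h)

/-- Every coordinate of a cube morphism depends on at most one coordinate. -/
theorem IsCubeMorphism.coord {n m : ℕ} {ψ : Cube n → Cube m} (hψ : IsCubeMorphism ψ) (i : Fin m) :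
    (∃ b, ∀ v, ψ v i = b) ∨ ∃ (k : Fin n) (b : Bool), ∀ v, ψ v i = xor b (v k) := by
  obtain ⟨L, c, hL⟩ := hψ
  let M : (Fin n → ℤ) →+ ℤ := (Pi.evalAddMonoidHom (fun _ => ℤ) i).comp L
  have hM : ∀ v, (if ψ v i then (1 : ℤ) else 0) = M v.toInt + c i := fun v => congrFun (hL v) i
  have h0 := hM ⊥
  have hbot : Cube.toInt (⊥ : Cube n) = 0 := by funext k; simp [Cube.toInt]
  rw [hbot, map_zero, zero_add] at h0
  have hs : ∀ k, Cube.toInt (Function.update (⊥ : Cube n) k true) = Pi.single k 1 := by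
    intro k
    funext l
    by_cases hl : l = k
    · subst hl
      simp [Cube.toInt]
    · simp [Cube.toInt, hl]
  by_cases hz : ∀ k, M (Pi.single k 1) = 0
  · left
    refine ⟨ψ ⊥ i, fun v => ?_⟩
    have h2 : M v.toInt = 0 := by
      rw [← Finset.univ_sum_single v.toInt, map_sum]
      refine Finset.sum_eq_zero fun k _ => ?_
      cases hv : v k <;> simp [Cube.toInt, hv, hz]
    have := hM v
    rw [h2, zero_add, ← h0] at this
    cases h3 : ψ v i <;> cases h4 : ψ ⊥ i <;> simp [h3, h4] at this ⊢
  · right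
    push Not at hz
    obtain ⟨k, hk⟩ := hz
    refine ⟨k, ψ ⊥ i, fun v => ?_⟩
    have h1 := hM (Function.update ⊥ k true)
    rw [hs] at h1
    have h2 : Cube.toInt (Function.update v k true) =
        Cube.toInt (Function.update v k false) + Pi.single k 1 := by
      funext l
      by_cases hl : l = k
      · subst hl
        simp [Cube.toInt]
      · simp [Cube.toInt, hl]
    have h3 := hM (Function.update v k true)
    have h4 := hM (Function.update v k false)
    rw [h2, map_add] at h3
    have h5 : ψ v i = if v k then ψ (Function.update v k true) i else
        ψ (Function.update v k false) i := by
      cases hv : v k <;> simp [← hv]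
    rw [h5]
    -- Raising coordinate `k` changes a value in `{0, 1}` by `t ≠ 0`. This determines both values,
    -- so they are the same at `v` as at `⊥`.
    revert h0 h1 h3 h4 hk
    generalize M (Pi.single k 1) = t
    generalize M (Cube.toInt (Function.update v k false)) = u
    cases v k <;> cases ψ ⊥ i <;> cases ψ (Function.update ⊥ k true) i <;>
      cases ψ (Function.update v k true) i <;> cases ψ (Function.update v k false) i <;>
      simp <;> omega

/-- A degree-`i` structure is contained in the degree-`(i + 1)` structure. -/
theorem degreeSpace_le_succ {A : Type*} [AddCommGroup A] {i n : ℕ} {f : Cube n → A}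
    (hf : f ∈ (degreeSpace i A).cubes n) : f ∈ (degreeSpace (i + 1) A).cubes n := by
  intro φ hφ
  rw [alternatingSum_insertNth 0, hf (fun v => φ _) (hφ.comp ?_), hf (fun v => φ _) (hφ.comp ?_),
    sub_zero]
  all_goals
    refine isCubeMorphism_of_coord fun j => ?_
    induction j using Fin.cases with
    | zero => exact Or.inl ⟨_, fun v => Fin.insertNth_apply_same _ _ _⟩
    | succ j => exact Or.inr (Or.inl ⟨j, fun v => by simp⟩)

/-- The product of a cube of degree `i` with a new coordinate has degree `i + 1`. -/
theorem ite_zero_mem_degreeSpace {A : Type*} [AddCommGroup A] {i n : ℕ} {f : Cube n → A}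
    (hf : f ∈ (degreeSpace i A).cubes n) :
    (fun v : Cube (n + 1) => if v 0 then f (fun j => v j.succ) else 0) ∈
      (degreeSpace (i + 1) A).cubes (n + 1) := by
  have htail : IsCubeMorphism (fun (v : Cube (n + 1)) (j : Fin n) => v j.succ) :=
    isCubeMorphism_of_coord fun j => Or.inr (Or.inl ⟨j.succ, fun _ => rfl⟩)
  intro φ hφ
  rcases hφ.coord 0 with ⟨b, hb⟩ | ⟨k, b, hb⟩
  · cases b
    · simp [hb]
    · simpa [hb] using degreeSpace_le_succ hf _ (htail.comp hφ)
  · have hface : ∀ t : Bool, ∑ v : Cube (i + 1), (-1 : ℤ) ^ v.height •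
        f (fun j => φ (k.insertNth (α := fun _ => Bool) t v) j.succ) = 0 := fun t =>
      hf _ ((htail.comp hφ).comp (χ := fun v => k.insertNth (α := fun _ => Bool) t v)
        (isCubeMorphism_of_coord fun j => by
          rcases Fin.eq_self_or_eq_succAbove k j with rfl | ⟨l, rfl⟩
          · exact Or.inl ⟨t, fun v => by simp⟩
          · exact Or.inr (Or.inl ⟨l, fun v => by simp⟩)))
    rw [alternatingSum_insertNth k]
    cases b <;> simp [hb, hface]

/-- Cubes of a degree structure lift along surjective homomorphisms. -/
theorem exists_lift_degreeSpace {A B : Type*} [AddCommGroup A] [AddCommGroup B] (p : A →+ B)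
    (hp : Function.Surjective p) (i n : ℕ) (f : Cube n → B)
    (hf : f ∈ (degreeSpace i B).cubes n) :
    ∃ g ∈ (degreeSpace i A).cubes n, ∀ v, p (g v) = f v := by
  induction n generalizing i with
  | zero =>
    obtain ⟨a, ha⟩ := hp (f ⊥)
    exact ⟨fun _ => a, const_mem_degreeSpace i 0 a, fun v => by rw [ha, Subsingleton.elim v ⊥]⟩
  | succ n ih =>
    have hcons : ∀ b : Bool, IsCubeMorphism fun v : Cube n => (Fin.cons b v : Cube (n + 1)) :=
      fun b => isCubeMorphism_of_coord fun j => by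
        induction j using Fin.cases with
        | zero => exact Or.inl ⟨b, fun v => rfl⟩
        | succ j => exact Or.inr (Or.inl ⟨j, fun v => rfl⟩)
    obtain ⟨g₀, hg₀, hg₀f⟩ := ih i _ ((degreeSpace i B).comp_mem _ (hcons false) f hf)
    have htail : (fun v : Cube (n + 1) => g₀ (fun j => v j.succ)) ∈
        (degreeSpace i A).cubes (n + 1) := (degreeSpace i A).comp_coord_mem hg₀ _ fun j =>
      Or.inr (Or.inl ⟨j.succ, fun _ => rfl⟩)
    have hv : ∀ v : Cube (n + 1), v = Fin.cons (v 0) fun j => v j.succ := fun v =>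
      (Fin.cons_self_tail v).symm
    cases i with
    -- In degree `0` cubes are constant along lines, so `f` ignores the first coordinate.
    | zero =>
      refine ⟨_, htail, fun v => ?_⟩
      rw [hg₀f, Function.comp_apply]
      have hline : IsCubeMorphism fun w : Cube 1 =>
          (Fin.cons (w 0) fun j => v j.succ : Cube (n + 1)) := isCubeMorphism_of_coord fun j => by
        induction j using Fin.cases with
        | zero => exact Or.inr (Or.inl ⟨0, fun w => rfl⟩)
        | succ j => exact Or.inl ⟨v j.succ, fun w => rfl⟩
      have := hf _ hline
      rw [alternatingSum_insertNth 0] at this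
      simp [Cube.height, sub_eq_zero] at this
      conv_rhs => rw [hv v]
      cases v 0
      · rfl
      · exact this
    | succ i =>
      -- `f` is its lower face plus the new coordinate times the difference of its two faces. That
      -- difference has degree one less, so the two parts are lifted separately.
      have hd : (fun v : Cube n => f (Fin.cons true v) - f (Fin.cons false v)) ∈
          (degreeSpace i B).cubes n := by
        intro φ hφ
        have := hf (fun w : Cube (i + 2) => Fin.cons (w 0) (φ fun j => w j.succ)) (by
          refine isCubeMorphism_of_coord fun j => ?_
          induction j using Fin.cases with
          | zero => exact Or.inr (Or.inl ⟨0, fun w => rfl⟩)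
          | succ j =>
            rcases hφ.coord j with ⟨b, hb⟩ | ⟨k, b, hb⟩
            · exact Or.inl ⟨b, fun w => hb _⟩
            · cases b
              · exact Or.inr (Or.inl ⟨k.succ, fun w => by simp [hb]⟩)
              · exact Or.inr (Or.inr ⟨k.succ, fun w => by simp [hb]⟩))
        rw [alternatingSum_insertNth 0] at this
        simp only [smul_sub, Finset.sum_sub_distrib]
        rw [← neg_sub, neg_eq_zero]
        simpa using this
      obtain ⟨h, hh, hhf⟩ := ih i _ hd
      refine ⟨_, add_mem_degreeSpace htail (ite_zero_mem_degreeSpace hh), fun v => ?_⟩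
      conv_rhs => rw [hv v]
      cases h0 : v 0
      · simp [h0, hg₀f]
      · simp [h0, hg₀f, hhf]


/-! ### Factoring through residues -/

theorem isMorphism_single {k : ℕ} (a : Fin k → ℕ) (y : (i : Fin k) → Fin (a i) → ℤ) (i : Fin k)
    (j : Fin (a i)) : IsMorphism (degreeSpace ((i : ℕ) + 1) ℤ) (freeNilspace a)
      (fun t => y + Pi.single i (Pi.single j t)) := by
  intro n c hc i'
  have h : (fun v => (Pi.single i (Pi.single j (c v)) : (i : Fin k) → Fin (a i) → ℤ) i') ∈
      (degreeSpace ((i' : ℕ) + 1) (Fin (a i') → ℤ)).cubes n := by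
    by_cases hi : i' = i
    · subst hi
      simpa using map_mem_degreeSpace (AddMonoidHom.single (fun _ : Fin (a i') => ℤ) j) hc
    · simpa [Pi.single_eq_of_ne hi] using const_mem_degreeSpace (A := Fin (a i') → ℤ) _ n 0
  exact add_mem_degreeSpace (const_mem_degreeSpace _ n (y i')) h

/-- The periods of `φ` form a subgroup, which contains `m` times each coordinate vector. -/
theorem eq_of_reduceMod_eq {N : Type*} {X : Cubespace N} {m : ℕ}
    (hX : ∀ i : ℕ, ∀ ψ : ℤ → N, IsMorphism (degreeSpace (i + 1) ℤ) X ψ → Function.Periodic ψ m)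
    {k : ℕ} (a : Fin k → ℕ) {φ : ((i : Fin k) → Fin (a i) → ℤ) → N}
    (hφ : IsMorphism (freeNilspace a) X φ) {x y : (i : Fin k) → Fin (a i) → ℤ}
    (hxy : reduceMod m a x = reduceMod m a y) : φ x = φ y := by
  let H : AddSubgroup ((i : Fin k) → Fin (a i) → ℤ) :=
    { carrier := {z | ∀ x, φ (x + z) = φ x}
      zero_mem' := fun x => by rw [add_zero]
      add_mem' := fun {z w} hz hw x => by rw [← add_assoc, hw, hz]
      neg_mem' := fun {z} hz x => by rw [← hz (x + -z), neg_add_cancel_right] }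
  have hsingle : ∀ (i : Fin k) (j : Fin (a i)) (t : ℤ),
      Pi.single i (Pi.single j (m * t)) ∈ H := fun i j t x => by
    have h := hX i (fun t => φ (x + Pi.single i (Pi.single j t))) fun n c hc => hφ n _ (isMorphism_single a x i j n c hc)
    have := h.int_mul t 0
    simpa [mul_comm] using this
  have hmem : y - x ∈ H := by
    rw [← Finset.univ_sum_single (y - x)]
    refine H.sum_mem fun i _ => ?_
    rw [← Finset.univ_sum_single ((y - x) i)]
    have : (Pi.single i (∑ j, Pi.single j ((y - x) i j)) : (i : Fin k) → Fin (a i) → ℤ) =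
        ∑ j, Pi.single i (Pi.single j ((y - x) i j)) :=
      map_sum (AddMonoidHom.single (fun i : Fin k => Fin (a i) → ℤ) i) _ _
    rw [this]
    refine H.sum_mem fun j _ => ?_
    obtain ⟨t, ht⟩ := (ZMod.intCast_eq_intCast_iff_dvd_sub _ _ _).1 (congrFun (congrFun hxy i) j)
    rw [show (y - x) i j = m * t from ht]
    exact hsingle i j t
  simpa using (hmem x).symm

theorem exists_factor {N : Type*} {X : Cubespace N} {m : ℕ}
    (hX : ∀ i : ℕ, ∀ ψ : ℤ → N, IsMorphism (degreeSpace (i + 1) ℤ) X ψ → Function.Periodic ψ m)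
    {k : ℕ} (a : Fin k → ℕ) {φ : ((i : Fin k) → Fin (a i) → ℤ) → N}
    (hφ : IsMorphism (freeNilspace a) X φ) :
    ∃ φ' : ((i : Fin k) → Fin (a i) → ZMod m) → N,
      IsMorphism (modFreeNilspace m a) X φ' ∧ φ = φ' ∘ reduceMod m a := by
  have hsurj : ∀ i, Function.Surjective
      ((Int.castAddHom (ZMod m)).compLeft (Fin (a i))) := fun i =>
    (ZMod.intCast_surjective (n := m)).comp_left
  let lift : ((i : Fin k) → Fin (a i) → ZMod m) → (i : Fin k) → Fin (a i) → ℤ :=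
    fun z i => Function.surjInv (hsurj i) (z i)
  have hlift : ∀ z, reduceMod m a (lift z) = z := fun z =>
    funext fun i => Function.surjInv_eq (hsurj i) (z i)
  have hfac : ∀ x, φ (lift (reduceMod m a x)) = φ x := fun x =>
    eq_of_reduceMod_eq hX a hφ (hlift _)
  refine ⟨φ ∘ lift, fun n c hc => ?_, funext fun x => (hfac x).symm⟩
  -- The pointwise section `lift` need not send cubes to cubes. A lift `g` of the whole cube does,
  -- and `φ` cannot distinguish the two.
  choose g hg hgc using fun i =>
    exists_lift_degreeSpace _ (hsurj i) ((i : ℕ) + 1) n (fun v => c v i) (hc i)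
  convert hφ n (fun v i => g i v) hg using 1
  funext v
  have : c v = reduceMod m a (fun i => g i v) := funext fun i => (hgc i v).symm
  simp only [Function.comp_apply]
  rw [this, hfac]

end Nilspaces

theorem mainTheorem6 {N : Type*} [Finite N] (X : Nilspaces.Cubespace N) (s : ℕ)
    (hX : X.IsStepNilspace s) :
    (∀ (k : ℕ) (a : Fin k → ℕ) (φ : ((i : Fin k) → Fin (a i) → ℤ) → N),
      Nilspaces.IsMorphism (Nilspaces.freeNilspace a) X φ →
        ∃ (α : ℕ) (φ' : ((i : Fin k) → Fin (a i) → ZMod (Nat.card N ^ α)) → N),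
          Nilspaces.IsMorphism (Nilspaces.modFreeNilspace (Nat.card N ^ α) a) X φ' ∧
            φ = φ' ∘ Nilspaces.reduceMod (Nat.card N ^ α) a) ∧
    (∃ α : ℕ, ∀ i : ℕ, 1 ≤ i → ∀ φ : ℤ → N,
      Nilspaces.IsMorphism (Nilspaces.degreeSpace i ℤ) X φ →
        ∀ x : ℤ, φ (x + (Nat.card N : ℤ) ^ α) = φ x) := by
  obtain ⟨α, hα⟩ := hX.exists_periodic
  refine ⟨fun k a φ hφ => ⟨α, Nilspaces.exists_factor (fun i ψ hψ => ?_) a hφ⟩, α, ?_⟩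
  · simpa using hα ψ hψ.affine_mem
  · rintro (_ | i) hi φ hφ
    · simp at hi
    · exact hα φ hφ.affine_mem
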